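/- Let $\mathcal H$ be a complex Hilbert space and $n\ge 0$ an integer. Let $\mathbf G_n\mathcal H\subset\mathcal B(\mathcal H)$ be the set of Hermitian (orthogonal) projections of rank $n$, and identify $\mathrm T^*\mathbf G_n\mathcal H$ in the standard way with the set of all bounded, not necessarily Hermitian, projections $q=q^2\in\mathcal B(\mathcal H)$ of rank $n$ (a projection $q$ with image $V$ corresponds to the covector at $V$ given by $q|_{V^\perp}\in\mathrm{Hom}(V^\perp,V)\cong \mathrm T^*_V\mathbf G_n\mathcal H$). Both are regarded as submanifolds of the Banach space $\mathcal B(\mathcal H)$. For $q\in \mathrm T^*\mathbf G_n\mathcal H$ let $\pi(q)\in\mathbf G_n\mathcal H$ be the orthogonal projection onto the image of $q$. On tangent vectors $A$ of $\mathrm T^*\mathbf G_n\mathcal H$ at $q$ define the complex structures $IA=iA$ and $JA=i[A,q]=i(Aq-qA)$; $J$ restricts to a complex structure on $\mathbf G_n\mathcal H$, also denoted $J$. Consider $$\Phi_n:\mathrm T^*\mathbf G_n\mathcal H\to\mathbf G_n\mathcal H\times\mathbf G_n\mathcal H,\qquad q\mapsto(\pi(q),\pi(q^*)).$$ Then: 1.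 $\Phi_n$ is holomorphic from $J$ to the product complex structure $(J,J)$, and it is a smooth open embedding (a diffeomorphism onto an open subset) with dense image. 2. The image of $\Phi_n$ is exactly the set of all $(p,q)\in\mathbf G_n\mathcal H\times\mathbf G_n\mathcal H$ such that $\mathcal H=p(\mathcal H)\oplus q(\mathcal H)^{\perp}$. 3. $\Phi_n$ is holomorphic from $I$ to the complex structure $(J,-J)$ on $\mathbf G_n\mathcal H\times\mathbf G_n\mathcal H$. 4. For $n=1$, where $\mathbf G_1\mathcal H=\mathbb P\mathcal H$, the image of $\Phi_1$ is exactly $\{(p,q)\in\mathbb P\mathcal H\times\mathbb P\mathcal H: pq\ne 0\}$, and its complement $\{pq=0\}$ is preserved by $(J,-J)$: if $(A,B)$ is tangent to the complement at $(p,q)$, then so is $(i[A,p],-i[B,q])$. -/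

import Mathlib

open scoped ContDiff Topology

namespace ProjGeom

/-! ### Differential geometry of subsets of real Banach spaces

Manifolds are given here as embedded submanifolds of a Banach space. Smooth maps are those which
locally extend to smooth maps of the ambient spaces, and tangent vectors are velocities of
smooth curves. -/

section Submanifolds

variable {E F : Type*} [NormedAddCommGroup E] [NormedSpace ℝ E]
  [NormedAddCommGroup F] [NormedSpace ℝ F]

/-- The tangent vectors of `S` at `x`: the velocities at time `0` of the smooth curves in the
ambient space which stay in `S` for small times and pass through `x` at time `0`. -/
def TangentVectors (S : Set E) (x : E) : Set E :=
  {v | ∃ γ : ℝ → E, ContDiff ℝ ∞ γ ∧ (∀ᶠ t in 𝓝 (0 : ℝ), γ t ∈ S) ∧ γ 0 = x ∧ HasDerivAt γ v 0}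

/-- `G` is a smooth extension of the map `f : S → S'` to the open neighbourhood `U` of `x`. -/
structure IsLocalExtension {S : Set E} {S' : Set F} (f : S → S') (x : S)
    (U : Set E) (G : E → F) : Prop where
  isOpen : IsOpen U
  mem : (x : E) ∈ U
  smooth : ContDiffOn ℝ ∞ G U
  agree : ∀ y : S, (y : E) ∈ U → G y = f y

/-- A map between subsets of Banach spaces is smooth if it locally extends to smooth maps of the
ambient spaces. -/
def IsSmoothMap {S : Set E} {S' : Set F} (f : S → S') : Prop :=
  ∀ x : S, ∃ (U : Set E) (G : E → F), IsLocalExtension f x U G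

/-- `L` represents the differential of `f : S → S'` at `x`: it is the derivative at `x` of a smooth
local extension of `f`. Only its restriction to the tangent vectors of `S` at `x` matters, and this
restriction does not depend on the extension. -/
def IsDifferentialAt {S : Set E} {S' : Set F} (f : S → S') (x : S) (L : E →L[ℝ] F) : Prop :=
  ∃ (U : Set E) (G : E → F), IsLocalExtension f x U G ∧ L = fderiv ℝ G x

/-- The subset `S` is preserved by the field of endomorphisms `J`: each `J x`, `x ∈ S`, maps
tangent vectors of `S` at `x` to tangent vectors of `S` at `x`. -/
def IsPreservedBy (S : Set E) (J : E → E →L[ℝ] E) : Prop :=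
  ∀ x ∈ S, ∀ v ∈ TangentVectors S x, J x v ∈ TangentVectors S x

/-- `J` restricts to an almost complex structure on `S`: it preserves the tangent spaces of `S`
and squares to `-1` on them. -/
def IsAlmostComplexOn (S : Set E) (J : E → E →L[ℝ] E) : Prop :=
  IsPreservedBy S J ∧ ∀ x ∈ S, ∀ v ∈ TangentVectors S x, J x (J x v) = -v

/-- `f : (S, J) → (S', J')` is a holomorphic map: `J`, `J'` are almost complex structures, `f` is
smooth, and `df ∘ J = J' ∘ df`. -/
structure IsHolomorphicMap {S : Set E} {S' : Set F} (J : E → E →L[ℝ] E) (J' : F → F →L[ℝ] F)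
    (f : S → S') : Prop where
  source : IsAlmostComplexOn S J
  target : IsAlmostComplexOn S' J'
  smooth : IsSmoothMap f
  comm : ∀ (x : S) (L : E →L[ℝ] F), IsDifferentialAt f x L →
    ∀ v ∈ TangentVectors S x, L (J x v) = J' (f x) (L v)

/-- `f : S → S'` is a smooth open embedding: a smooth map which is a homeomorphism onto an open
subset of `S'` and whose inverse, defined on this open subset, is smooth. -/
structure IsSmoothOpenEmbedding {S : Set E} {S' : Set F} (f : S → S') : Prop where
  smooth : IsSmoothMap f
  isOpenEmbedding : Topology.IsOpenEmbedding f
  smooth_inverse : ∀ x : S, ∃ (U : Set F) (G : F → E), IsOpen U ∧ (f x : F) ∈ U ∧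
    ContDiffOn ℝ ∞ G U ∧ ∀ y : S, (f y : F) ∈ U → G (f y) = y

end Submanifolds

/-! ### Projections -/

section Projections

variable (H : Type*) [NormedAddCommGroup H] [InnerProductSpace ℂ H] [CompleteSpace H]

/-- `T*G_n(H)`: the (not necessarily Hermitian) bounded projections of rank `n` of `H`. -/
def CotangentGrassmannian (n : ℕ) : Set (H →L[ℂ] H) :=
  {q | q * q = q ∧ Module.rank ℂ q.range = n}

/-- `G_n(H)`: the Hermitian projections of rank `n` of `H`. -/
def Grassmannian (n : ℕ) : Set (H →L[ℂ] H) :=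
  {p | p * p = p ∧ Module.rank ℂ p.range = n ∧ IsSelfAdjoint p}

variable {H}

/-- The complex structure `I`, `A ↦ i A`. -/
noncomputable def structureI (_q : H →L[ℂ] H) : (H →L[ℂ] H) →L[ℝ] (H →L[ℂ] H) :=
  Complex.I • ContinuousLinearMap.id ℝ (H →L[ℂ] H)

/-- The complex structure `J`, `A ↦ i [A, q]`. -/
noncomputable def structureJ (q : H →L[ℂ] H) : (H →L[ℂ] H) →L[ℝ] (H →L[ℂ] H) :=
  Complex.I • ((ContinuousLinearMap.mul ℝ (H →L[ℂ] H)).flip q -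
    ContinuousLinearMap.mul ℝ (H →L[ℂ] H) q)

theorem structureI_apply (q A : H →L[ℂ] H) : structureI q A = Complex.I • A := rfl

theorem structureJ_apply (q A : H →L[ℂ] H) :
    structureJ q A = Complex.I • (A * q - q * A) := rfl

/-- The product complex structure `(J, J)`. -/
noncomputable def structureJJ (x : (H →L[ℂ] H) × (H →L[ℂ] H)) :
    ((H →L[ℂ] H) × (H →L[ℂ] H)) →L[ℝ] ((H →L[ℂ] H) × (H →L[ℂ] H)) :=
  (structureJ x.1).prodMap (structureJ x.2)

/-- The complex structure `(J, -J)`. -/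
noncomputable def structureJnegJ (x : (H →L[ℂ] H) × (H →L[ℂ] H)) :
    ((H →L[ℂ] H) × (H →L[ℂ] H)) →L[ℝ] ((H →L[ℂ] H) × (H →L[ℂ] H)) :=
  (structureJ x.1).prodMap (-structureJ x.2)

theorem finiteDimensional_range {n : ℕ} {q : H →L[ℂ] H} (hq : Module.rank ℂ q.range = n) :
    FiniteDimensional ℂ q.range := by
  apply Module.rank_lt_aleph0_iff.mp
  rw [hq]
  exact Cardinal.natCast_lt_aleph0

theorem rank_range_adjoint_le (q : H →L[ℂ] H) :
    Module.rank ℂ (ContinuousLinearMap.adjoint q).range ≤ Module.rank ℂ q.range := by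
  have hmem : ∀ x : (ContinuousLinearMap.adjoint q).range, q x ∈ q.range := fun x => ⟨x, rfl⟩
  let T : (ContinuousLinearMap.adjoint q).range →ₗ[ℂ] q.range :=
    ((q : H →ₗ[ℂ] H).comp (Submodule.subtype _)).codRestrict _ hmem
  refine LinearMap.rank_le_of_injective T ?_
  rw [injective_iff_map_eq_zero]
  rintro ⟨x, y, rfl⟩ hx
  have hx' : q (ContinuousLinearMap.adjoint q y) = 0 := congrArg Subtype.val hx
  apply Subtype.ext
  change ContinuousLinearMap.adjoint q y = 0
  rw [← inner_self_eq_zero (𝕜 := ℂ), ContinuousLinearMap.adjoint_inner_left, hx',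
    inner_zero_right]

theorem adjoint_mem {n : ℕ} {q : H →L[ℂ] H} (hq : q ∈ CotangentGrassmannian H n) :
    ContinuousLinearMap.adjoint q ∈ CotangentGrassmannian H n := by
  refine ⟨?_, le_antisymm ?_ ?_⟩
  · rw [← ContinuousLinearMap.star_eq_adjoint, ← star_mul, hq.1]
  · exact (rank_range_adjoint_le q).trans hq.2.le
  · have h := rank_range_adjoint_le (ContinuousLinearMap.adjoint q)
    rw [ContinuousLinearMap.adjoint_adjoint, hq.2] at h
    exact h

/-- The involution `q ↦ q*` of `T*G_n(H)`. -/
noncomputable def adjointMap {n : ℕ} (q : CotangentGrassmannian H n) : CotangentGrassmannian H n :=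
  ⟨ContinuousLinearMap.adjoint (q : H →L[ℂ] H), adjoint_mem q.2⟩

/-- The map `π : T*G_n(H) → G_n(H)`: `π(q)` is the orthogonal projection onto the image
of `q`. -/
noncomputable def proj {n : ℕ} (q : CotangentGrassmannian H n) : Grassmannian H n :=
  haveI : FiniteDimensional ℂ (q : H →L[ℂ] H).range := finiteDimensional_range q.2.2
  ⟨(q : H →L[ℂ] H).range.starProjection,
    (q : H →L[ℂ] H).range.isIdempotentElem_starProjection,
    by rw [Submodule.range_starProjection]; exact q.2.2,
    isSelfAdjoint_starProjection _⟩

/-- The map `T*G_n(H) → G_n(H) × G_n(H)`, `q ↦ (π(q), π(q*))`. -/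
noncomputable def compactification (n : ℕ) (q : CotangentGrassmannian H n) :
    ↥(Grassmannian H n ×ˢ Grassmannian H n) :=
  ⟨(proj q, proj (adjointMap q)), (proj q).2, (proj (adjointMap q)).2⟩

end Projections

end ProjGeom

open ProjGeom

/-!
Everything rests on explicit algebra with idempotents; `p = π(q)` and `p' = π(q*)` below.

*Tangent spaces.* Differentiating `q² = q` gives `v q + q v = v` for tangent vectors of the space
of idempotents, and moreover `v* = v` for the Hermitian ones. Conversely such a `v` equals
`[[v, q], q]`, hence is the velocity of `t ↦ exp(tX) q exp(-tX)` with `X = [v, q]`, which is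
skew-adjoint if `v` and `q` are Hermitian. All statements about almost complex structures become
identities between operators.

*Smoothness and the inverse.* The relations `p q = q`, `q p = p`, `p' q = p'`, `q p' = q` show that
`p = q (q + q* - 1)⁻¹` (`projExtension_eq`) and `q = (p p' p + 1 - p)⁻¹ p p'`
(`inverseExtension_compactification`), where the two inverses are `p + p' - 1` and
`q q* + 1 - p`. Both formulas are smooth on open sets of operators, so the map is a smooth
embedding.

*The differential.* The derivative of `π` at `q` in the direction `v` is `a + a*` with
`a = (1 - p) v p` (`differential_compactification`). Replacing `v` by `i v` or by `i [v, q]`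
replaces `a` by `i a`, and `J` acts on `a + a*` in the same way. For the second component `v` is
replaced by `v*`, and taking adjoints turns `i v` into `-i v*` but commutes with `J`.

*The image.* An idempotent is determined by its image and its kernel, the kernel of `q` being the
orthogonal complement of the image of `q*`. This gives the description of the image by
`IsCompl` (`range_compactification`); for equal finite ranks it is enough that the image of `p` and
the kernel of `p'` intersect trivially. The latter holds if `p p' p + 1 - p` is invertible, so the
image is open. For density, `p'` is moved by `g = 1 + t K*`, where `K` maps the image `V` of `p`
isomorphically to the image of `p'` and vanishes on `Vᗮ`; a nonzero vector in the bad intersection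
would be an eigenvector, with eigenvalue `-t`, of a fixed endomorphism of the finite-dimensional
space `V`, which is impossible for all but finitely many `t` (`denseRange_compactification`).

*The complement for `n = 1`.* It consists of the pairs with `p p' = 0`. Its tangent vectors at such
a pair are the tangent vectors `(A, B)` of the product with `A p' + p B = 0`
(`mem_tangentVectors_orthogonal_pairs`), because a common skew-adjoint generator `X` with
`[X, p] = A`, `[X, p'] = B` exists. This linear condition is stable under `(J, -J)`.
-/

namespace ProjGeom

/-! ### Identities for idempotents and their tangent vectors -/

section Ring

variable {R : Type*} [Ring R] {q v : R}

theorem mul_mul_eq_zero_of_tangent (hq : q * q = q) (h : v * q + q * v = v) : q * v * q = 0 := by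
  linear_combination (norm := noncomm_ring) q * h - hq * v

theorem commutator_tangent (hq : q * q = q) :
    (v * q - q * v) * q + q * (v * q - q * v) = v * q - q * v := by
  linear_combination (norm := noncomm_ring) v * hq - hq * v

/-- A tangent vector at `q` is recovered by taking the commutator with `q` twice. This produces
both the generator of a curve with velocity `v` and the identity `J² = -1`. -/
theorem commutator_commutator (hq : q * q = q) (h : v * q + q * v = v) :
    (v * q - q * v) * q - q * (v * q - q * v) = v := by
  linear_combination (norm := noncomm_ring)
    v * hq + hq * v + h - (2 : R) * mul_mul_eq_zero_of_tangent hq h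

end Ring

section Operators

variable {H : Type*} [NormedAddCommGroup H] [InnerProductSpace ℂ H] [CompleteSpace H]
  {n : ℕ} {p p' q v w X : H →L[ℂ] H}

theorem structureJ_tangent (hq : q * q = q) :
    structureJ q v * q + q * structureJ q v = structureJ q v := by
  rw [structureJ_apply, smul_mul_assoc, mul_smul_comm, ← smul_add, commutator_tangent hq]

theorem structureJ_structureJ (hq : q * q = q) (h : v * q + q * v = v) :
    structureJ q (structureJ q v) = -v := by
  rw [structureJ_apply, structureJ_apply, smul_mul_assoc, mul_smul_comm, ← smul_sub,
    commutator_commutator hq h, smul_smul, Complex.I_mul_I, neg_one_smul]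

theorem star_structureJ : star (structureJ q v) = structureJ (star q) (star v) := by
  rw [structureJ_apply, structureJ_apply, star_smul, star_sub, star_mul, star_mul,
    RCLike.star_def, Complex.conj_I, neg_smul, ← smul_neg, neg_sub]

/-! ### Conjugation by one-parameter groups -/

theorem exp_mul_exp_neg (X : H →L[ℂ] H) : NormedSpace.exp X * NormedSpace.exp (-X) = 1 := by
  let : NormedAlgebra ℚ (H →L[ℂ] H) := NormedAlgebra.restrictScalars ℚ ℝ _
  rw [← NormedSpace.exp_add_of_commute (Commute.refl X).neg_right, add_neg_cancel,
    NormedSpace.exp_zero]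

theorem exp_neg_mul_exp (X : H →L[ℂ] H) : NormedSpace.exp (-X) * NormedSpace.exp X = 1 := by
  simpa using exp_mul_exp_neg (-X)

theorem star_exp_of_star_eq_neg (hX : star X = -X) :
    star (NormedSpace.exp X) = NormedSpace.exp (-X) := by
  rw [NormedSpace.star_exp, hX]

/-- The orbit of `q` under conjugation by the one-parameter group generated by `X`. -/
noncomputable def conjCurve (X q : H →L[ℂ] H) (t : ℝ) : H →L[ℂ] H :=
  NormedSpace.exp (t • X) * q * NormedSpace.exp (-(t • X))

theorem conjCurve_zero : conjCurve X q 0 = q := by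
  simp [conjCurve, NormedSpace.exp_zero]

theorem contDiff_conjCurve : ContDiff ℝ ∞ (conjCurve X q) := by
  have he : ContDiff ℝ ∞ (NormedSpace.exp : (H →L[ℂ] H) → (H →L[ℂ] H)) :=
    contDiff_iff_contDiffAt.2 fun x => (NormedSpace.exp_analytic (𝕂 := ℝ) x).contDiffAt
  have h1 : ContDiff ℝ ∞ fun t : ℝ => t • X := contDiff_id.smul contDiff_const
  exact ((he.comp h1).mul contDiff_const).mul (he.comp h1.neg)

theorem hasDerivAt_conjCurve : HasDerivAt (conjCurve X q) (X * q - q * X) 0 := by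
  have h1 := hasDerivAt_exp_smul_const (𝕂 := ℝ) X (0 : ℝ)
  have h2 := hasDerivAt_exp_smul_const (𝕂 := ℝ) (-X) (0 : ℝ)
  have h3 := (h1.mul_const q).mul h2
  simp only [zero_smul, NormedSpace.exp_zero, one_mul, mul_neg, smul_neg,
    neg_zero, mul_one] at h3
  rw [sub_eq_add_neg]
  exact h3

theorem conjCurve_mul_conjCurve (t : ℝ) :
    conjCurve X p t * conjCurve X q t = conjCurve X (p * q) t := by
  simp only [conjCurve]
  linear_combination (norm := noncomm_ring) NormedSpace.exp (t • X) * p *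
    exp_neg_mul_exp (t • X) * q * NormedSpace.exp (-(t • X))

theorem star_conjCurve (hX : star X = -X) (t : ℝ) :
    star (conjCurve X q t) = conjCurve X (star q) t := by
  have h : star (t • X) = -(t • X) := by rw [star_smul, hX, smul_neg, star_trivial]
  have h' : star (NormedSpace.exp (-(t • X))) = NormedSpace.exp (t • X) := by
    rw [← star_exp_of_star_eq_neg h, star_star]
  rw [conjCurve, star_mul, star_mul, star_exp_of_star_eq_neg h, h', conjCurve, mul_assoc]

omit [CompleteSpace H] in
theorem rank_range_mul_mul_le (u q w : H →L[ℂ] H) :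
    Module.rank ℂ (u * q * w).range ≤ Module.rank ℂ q.range :=
  (LinearMap.rank_comp_le_left (w : H →ₗ[ℂ] H) ((u * q : H →L[ℂ] H) : H →ₗ[ℂ] H)).trans
    (LinearMap.rank_comp_le_right (q : H →ₗ[ℂ] H) (u : H →ₗ[ℂ] H))

theorem conj_mem_cotangentGrassmannian (hwu : w * u = 1)
    (hq : q ∈ CotangentGrassmannian H n) : u * q * w ∈ CotangentGrassmannian H n := by
  refine ⟨?_, le_antisymm ((rank_range_mul_mul_le u q w).trans hq.2.le) ?_⟩
  · linear_combination (norm := noncomm_ring) u * q * hwu * q * w + u * hq.1 * w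
  · have h : w * (u * q * w) * u = q := by
      linear_combination (norm := noncomm_ring) hwu * q * w * u + q * hwu
    have := rank_range_mul_mul_le w (u * q * w) u
    rwa [h, hq.2] at this

theorem mem_grassmannian_iff :
    p ∈ Grassmannian H n ↔ p ∈ CotangentGrassmannian H n ∧ star p = p :=
  ⟨fun h => ⟨⟨h.1, h.2.1⟩, h.2.2⟩, fun h => ⟨h.1.1, h.1.2, h.2⟩⟩

theorem conjCurve_mem_cotangentGrassmannian (hq : q ∈ CotangentGrassmannian H n) (t : ℝ) :
    conjCurve X q t ∈ CotangentGrassmannian H n :=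
  conj_mem_cotangentGrassmannian (exp_neg_mul_exp _) hq

theorem conjCurve_mem_grassmannian (hX : star X = -X) (hp : p ∈ Grassmannian H n) (t : ℝ) :
    conjCurve X p t ∈ Grassmannian H n := by
  rw [mem_grassmannian_iff] at hp ⊢
  exact ⟨conjCurve_mem_cotangentGrassmannian hp.1 t, by rw [star_conjCurve hX, hp.2]⟩

/-! ### Tangent spaces -/

/-- Differentiating an identity `γ₁ γ₂ = γ₃` between curves of operators. -/
theorem deriv_mul_eq {γ₁ γ₂ γ₃ : ℝ → H →L[ℂ] H} {v₁ v₂ v₃ : H →L[ℂ] H}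
    (h₁ : HasDerivAt γ₁ v₁ 0) (h₂ : HasDerivAt γ₂ v₂ 0) (h₃ : HasDerivAt γ₃ v₃ 0)
    (h : ∀ᶠ t in 𝓝 (0 : ℝ), γ₁ t * γ₂ t = γ₃ t) : v₁ * γ₂ 0 + γ₁ 0 * v₂ = v₃ :=
  (h₁.mul h₂).unique (h₃.congr_of_eventuallyEq h)

theorem hasDerivAt_star {γ : ℝ → H →L[ℂ] H} (h : HasDerivAt γ v 0) :
    HasDerivAt (fun t => star (γ t)) (star v) 0 :=
  (starL' ℝ : (H →L[ℂ] H) ≃L[ℝ] (H →L[ℂ] H)).toContinuousLinearMap.hasFDerivAt.comp_hasDerivAt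
    (0 : ℝ) h

/-- The tangent space of the space of idempotents is cut out by the linearization of `q² = q`. -/
theorem mem_tangentVectors_cotangentGrassmannian (hq : q ∈ CotangentGrassmannian H n) :
    v ∈ TangentVectors (CotangentGrassmannian H n) q ↔ v * q + q * v = v := by
  constructor
  · rintro ⟨γ, -, hγ, h0, hv⟩
    have := deriv_mul_eq hv hv hv (hγ.mono fun t ht => ht.1)
    rwa [h0] at this
  · intro h
    refine ⟨conjCurve (v * q - q * v) q, contDiff_conjCurve,
      .of_forall fun t => conjCurve_mem_cotangentGrassmannian hq t, conjCurve_zero, ?_⟩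
    simpa only [commutator_commutator hq.1 h] using
      hasDerivAt_conjCurve (X := v * q - q * v) (q := q)

theorem star_commutator (hp : star p = p) (hv : star v = v) :
    star (v * p - p * v) = -(v * p - p * v) := by
  rw [star_sub, star_mul, star_mul, hp, hv, neg_sub]

theorem mem_tangentVectors_grassmannian (hp : p ∈ Grassmannian H n) :
    v ∈ TangentVectors (Grassmannian H n) p ↔ v * p + p * v = v ∧ star v = v := by
  constructor
  · rintro ⟨γ, -, hγ, h0, hv⟩
    have := deriv_mul_eq hv hv hv (hγ.mono fun t ht => ht.1)
    rw [h0] at this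
    exact ⟨this, (hasDerivAt_star hv).unique
      (hv.congr_of_eventuallyEq (hγ.mono fun t ht => ht.2.2))⟩
  · rintro ⟨h, hs⟩
    refine ⟨conjCurve (v * p - p * v) p, contDiff_conjCurve,
      .of_forall fun t => conjCurve_mem_grassmannian (star_commutator hp.2.2 hs) hp t,
      conjCurve_zero, ?_⟩
    simpa only [commutator_commutator hp.1 h] using
      hasDerivAt_conjCurve (X := v * p - p * v) (q := p)

theorem mem_tangentVectors_prod {E F : Type*} [NormedAddCommGroup E] [NormedSpace ℝ E]
    [NormedAddCommGroup F] [NormedSpace ℝ F] {S : Set E} {S' : Set F} {x v : E × F} :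
    v ∈ TangentVectors (S ×ˢ S') x ↔
      v.1 ∈ TangentVectors S x.1 ∧ v.2 ∈ TangentVectors S' x.2 := by
  constructor
  · rintro ⟨γ, hs, hγ, h0, hv⟩
    exact ⟨⟨fun t => (γ t).1, hs.fst, hγ.mono fun t ht => ht.1, congrArg Prod.fst h0,
        (ContinuousLinearMap.fst ℝ E F).hasFDerivAt.comp_hasDerivAt (0 : ℝ) hv⟩,
      ⟨fun t => (γ t).2, hs.snd, hγ.mono fun t ht => ht.2, congrArg Prod.snd h0,
        (ContinuousLinearMap.snd ℝ E F).hasFDerivAt.comp_hasDerivAt (0 : ℝ) hv⟩⟩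
  · rintro ⟨⟨γ, hs, hγ, h0, hv⟩, ⟨γ', hs', hγ', h0', hv'⟩⟩
    exact ⟨fun t => (γ t, γ' t), hs.prodMk hs', (hγ.and hγ').mono fun t ht => ht,
      Prod.ext h0 h0', hv.prodMk hv'⟩

/-! ### The almost complex structures -/

theorem isAlmostComplexOn_structureI :
    IsAlmostComplexOn (CotangentGrassmannian H n) structureI := by
  refine ⟨fun q hq v hv => ?_, fun q hq v hv => ?_⟩
  · rw [mem_tangentVectors_cotangentGrassmannian hq] at hv ⊢
    rw [structureI_apply, smul_mul_assoc, mul_smul_comm, ← smul_add, hv]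
  · rw [structureI_apply, structureI_apply, smul_smul, Complex.I_mul_I, neg_one_smul]

theorem isAlmostComplexOn_structureJ :
    IsAlmostComplexOn (CotangentGrassmannian H n) structureJ := by
  refine ⟨fun q hq v hv => ?_, fun q hq v hv => ?_⟩
  · rw [mem_tangentVectors_cotangentGrassmannian hq]
    exact structureJ_tangent hq.1
  · exact structureJ_structureJ hq.1 ((mem_tangentVectors_cotangentGrassmannian hq).1 hv)

theorem isAlmostComplexOn_grassmannian_structureJ :
    IsAlmostComplexOn (Grassmannian H n) structureJ := by
  refine ⟨fun p hp v hv => ?_, fun p hp v hv => ?_⟩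
  · rw [mem_tangentVectors_grassmannian hp] at hv ⊢
    exact ⟨structureJ_tangent hp.1, by rw [star_structureJ, hp.2.2, hv.2]⟩
  · exact structureJ_structureJ hp.1 ((mem_tangentVectors_grassmannian hp).1 hv).1

theorem isAlmostComplexOn_grassmannian_neg_structureJ :
    IsAlmostComplexOn (Grassmannian H n) (fun p => -structureJ p) := by
  refine ⟨fun p hp v hv => ?_, fun p hp v hv => ?_⟩
  · have h := isAlmostComplexOn_grassmannian_structureJ.1 p hp v hv
    rw [mem_tangentVectors_grassmannian hp] at h ⊢
    simp only [neg_apply, neg_mul, mul_neg, ← neg_add, star_neg, h.1, h.2, and_self]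
  · simpa using isAlmostComplexOn_grassmannian_structureJ.2 p hp v hv

theorem IsAlmostComplexOn.prod {E F : Type*} [NormedAddCommGroup E] [NormedSpace ℝ E]
    [NormedAddCommGroup F] [NormedSpace ℝ F] {S : Set E} {S' : Set F} {J : E → E →L[ℝ] E}
    {J' : F → F →L[ℝ] F} (h : IsAlmostComplexOn S J) (h' : IsAlmostComplexOn S' J') :
    IsAlmostComplexOn (S ×ˢ S') (fun x => (J x.1).prodMap (J' x.2)) := by
  refine ⟨fun x hx v hv => ?_, fun x hx v hv => ?_⟩ <;> rw [mem_tangentVectors_prod] at hv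
  · exact mem_tangentVectors_prod.2 ⟨h.1 _ hx.1 _ hv.1, h'.1 _ hx.2 _ hv.2⟩
  · exact Prod.ext (h.2 _ hx.1 _ hv.1) (h'.2 _ hx.2 _ hv.2)

theorem isAlmostComplexOn_structureJJ :
    IsAlmostComplexOn (Grassmannian H n ×ˢ Grassmannian H n) structureJJ :=
  isAlmostComplexOn_grassmannian_structureJ.prod isAlmostComplexOn_grassmannian_structureJ

theorem isAlmostComplexOn_structureJnegJ :
    IsAlmostComplexOn (Grassmannian H n ×ˢ Grassmannian H n) structureJnegJ := by
  have h := (isAlmostComplexOn_grassmannian_structureJ (H := H) (n := n)).prod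
    (isAlmostComplexOn_grassmannian_neg_structureJ (H := H) (n := n))
  exact h

/-! ### The projection `π` and its smooth extension -/

theorem proj_mul_self (q : CotangentGrassmannian H n) : (proj q).1 * q.1 = q.1 := by
  have : FiniteDimensional ℂ q.1.range := finiteDimensional_range q.2.2
  ext x
  exact Submodule.starProjection_eq_self_iff.2 ⟨x, rfl⟩

theorem self_mul_proj (q : CotangentGrassmannian H n) : q.1 * (proj q).1 = (proj q).1 := by
  have : FiniteDimensional ℂ q.1.range := finiteDimensional_range q.2.2
  ext x
  obtain ⟨y, hy⟩ := Submodule.starProjection_apply_mem q.1.range x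
  change q.1 (q.1.range.starProjection x) = q.1.range.starProjection x
  rw [← hy]
  exact congrArg (fun f : H →L[ℂ] H => f y) q.2.1

theorem star_proj (q : CotangentGrassmannian H n) : star (proj q).1 = (proj q).1 :=
  (proj q).2.2.2

theorem self_mul_proj_adjointMap (q : CotangentGrassmannian H n) :
    q.1 * (proj (adjointMap q)).1 = q.1 := by
  have h : (proj (adjointMap q)).1 * star q.1 = star q.1 := proj_mul_self (adjointMap q)
  simpa only [star_mul, star_star, star_proj] using congrArg star h

theorem proj_adjointMap_mul_self (q : CotangentGrassmannian H n) :
    (proj (adjointMap q)).1 * q.1 = (proj (adjointMap q)).1 := by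
  have h : star q.1 * (proj (adjointMap q)).1 = (proj (adjointMap q)).1 :=
    self_mul_proj (adjointMap q)
  simpa only [star_mul, star_star, star_proj] using congrArg star h

/-- The relations `p q = q` and `q p = p` say that `p` and `q` have the same image; together with
`p* = p` they characterize `π(q)`. -/
theorem proj_eq_of_mul_eq (q : CotangentGrassmannian H n) (hp : star p = p)
    (hpq : p * q.1 = q.1) (hqp : q.1 * p = p) : (proj q).1 = p := by
  have h₁ : (proj q).1 = p * (proj q).1 := by
    rw [← self_mul_proj q, ← mul_assoc, hpq]
  have h₂ : p = (proj q).1 * p := by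
    rw [← hqp, ← mul_assoc, proj_mul_self]
  have h₃ := congrArg star h₂
  rw [star_mul, star_proj, hp] at h₃
  rw [h₁, ← h₃]

theorem star_self_mul_proj (q : CotangentGrassmannian H n) :
    (proj q).1 * star q.1 = (proj q).1 := by
  simpa only [star_mul, star_proj] using congrArg star (self_mul_proj q)

/-- For an idempotent `q`, the operator `q + q* - 1` is invertible, and its inverse is
`π(q) + π(q*) - 1`. -/
theorem isUnit_add_star_sub_one (q : CotangentGrassmannian H n) :
    IsUnit (q.1 + star q.1 - 1) := by
  have h₁ := star_self_mul_proj q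
  have h₂ : (proj (adjointMap q)).1 * star q.1 = star q.1 := proj_mul_self (adjointMap q)
  have h : ((proj q).1 + (proj (adjointMap q)).1 - 1) * (q.1 + star q.1 - 1) = 1 := by
    linear_combination (norm := noncomm_ring) proj_mul_self q + h₁ +
      proj_adjointMap_mul_self q + h₂
  have h' := congrArg star h
  simp only [star_mul, star_add, star_sub, star_one, star_star, star_proj] at h'
  exact ⟨⟨_, _, by rw [add_comm q.1]; exact h', h⟩, rfl⟩

/-- The formula `q (q + q* - 1)⁻¹` for the orthogonal projection onto the image of an
idempotent `q`, as a function on all operators. -/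
noncomputable def projExtension (a : H →L[ℂ] H) : H →L[ℂ] H :=
  a * Ring.inverse (a + star a - 1)

theorem projExtension_eq (q : CotangentGrassmannian H n) : projExtension q.1 = (proj q).1 := by
  have h : (proj q).1 * (q.1 + star q.1 - 1) = q.1 := by
    linear_combination (norm := noncomm_ring) proj_mul_self q + star_self_mul_proj q
  calc projExtension q.1
      = (proj q).1 * (q.1 + star q.1 - 1) * Ring.inverse (q.1 + star q.1 - 1) := by
        rw [h, projExtension]
    _ = (proj q).1 := Ring.mul_inverse_cancel_right _ _ (isUnit_add_star_sub_one q)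

theorem contDiff_star : ContDiff ℝ ∞ (star : (H →L[ℂ] H) → (H →L[ℂ] H)) :=
  (starL' ℝ : (H →L[ℂ] H) ≃L[ℝ] (H →L[ℂ] H)).contDiff

theorem contDiffAt_ringInverse_of_isUnit {a : H →L[ℂ] H} (ha : IsUnit a) :
    ContDiffAt ℝ ∞ Ring.inverse a := by
  obtain ⟨u, rfl⟩ := ha
  exact contDiffAt_ringInverse ℝ u

theorem contDiffOn_projExtension :
    ContDiffOn ℝ ∞ (projExtension : (H →L[ℂ] H) → _) {a | IsUnit (a + star a - 1)} := by
  intro a ha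
  have h : ContDiff ℝ ∞ fun b : H →L[ℂ] H => b + star b - 1 :=
    (contDiff_id.add contDiff_star).sub contDiff_const
  exact (contDiffAt_id.mul
    ((contDiffAt_ringInverse_of_isUnit ha).comp a h.contDiffAt)).contDiffWithinAt

theorem isOpen_isUnit_add_star_sub_one :
    IsOpen {a : H →L[ℂ] H | IsUnit (a + star a - 1)} :=
  Units.isOpen.preimage ((contDiff_id.add contDiff_star).sub contDiff_const :
    ContDiff ℝ ∞ fun b : H →L[ℂ] H => b + star b - 1).continuous

theorem isLocalExtension_compactification (x : CotangentGrassmannian H n) :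
    IsLocalExtension (compactification n) x {a | IsUnit (a + star a - 1)}
      (fun a => (projExtension a, projExtension (star a))) where
  isOpen := isOpen_isUnit_add_star_sub_one
  mem := isUnit_add_star_sub_one x
  smooth := by
    refine contDiffOn_projExtension.prodMk
      (contDiffOn_projExtension.comp contDiff_star.contDiffOn fun a ha => ?_)
    rw [Set.mem_ofPred_eq, star_star, add_comm]
    exact ha
  agree y _ := Prod.ext (projExtension_eq y) (projExtension_eq (adjointMap y))

theorem isSmoothMap_compactification :
    IsSmoothMap (compactification (H := H) n) :=
  fun x => ⟨_, _, isLocalExtension_compactification x⟩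

/-! ### The inverse of the compactification map -/

/-- The operator `p p' p + (1 - p)` attached to a pair `(p, p')`. For Hermitian projections of
the same finite rank it is invertible exactly when `p'` restricts to an isomorphism between their
images. -/
noncomputable def gram (x : (H →L[ℂ] H) × (H →L[ℂ] H)) : H →L[ℂ] H :=
  x.1 * x.2 * x.1 + 1 - x.1

/-- The formula `(p p' p + 1 - p)⁻¹ p p'` recovering `q` from `p = π(q)` and `p' = π(q*)`. -/
noncomputable def inverseExtension (x : (H →L[ℂ] H) × (H →L[ℂ] H)) : H →L[ℂ] H :=
  Ring.inverse (gram x) * (x.1 * x.2)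

theorem contDiff_gram :
    ContDiff ℝ ∞ (gram : (H →L[ℂ] H) × (H →L[ℂ] H) → (H →L[ℂ] H)) :=
  (((contDiff_fst.mul contDiff_snd).mul contDiff_fst).add contDiff_const).sub contDiff_fst

theorem isOpen_isUnit_gram :
    IsOpen {x : (H →L[ℂ] H) × (H →L[ℂ] H) | IsUnit (gram x)} :=
  Units.isOpen.preimage contDiff_gram.continuous

theorem contDiffOn_inverseExtension :
    ContDiffOn ℝ ∞ (inverseExtension : (H →L[ℂ] H) × (H →L[ℂ] H) → (H →L[ℂ] H))
      {x | IsUnit (gram x)} := fun x hx =>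
  (((contDiffAt_ringInverse_of_isUnit hx).comp x contDiff_gram.contDiffAt).mul
    (contDiff_fst.mul contDiff_snd).contDiffAt).contDiffWithinAt

/-- On the image of the compactification map `gram` is invertible, with inverse
`q q* + 1 - π(q)`. -/
theorem isUnit_gram_compactification (q : CotangentGrassmannian H n) :
    IsUnit (gram (compactification n q).1) := by
  have h₁ := proj_mul_self q
  have h₂ := self_mul_proj q
  have h₃ := self_mul_proj_adjointMap q
  have h₄ := proj_adjointMap_mul_self q
  have h₅ := star_self_mul_proj q
  have h₆ : (proj (adjointMap q)).1 * star q.1 = star q.1 := proj_mul_self (adjointMap q)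
  have h₇ : star q.1 * (proj (adjointMap q)).1 = (proj (adjointMap q)).1 :=
    self_mul_proj (adjointMap q)
  have h₈ : star q.1 * (proj q).1 = star q.1 := by
    simpa only [star_mul, star_proj] using congrArg star h₁
  have h₉ := (proj q).2.1
  change IsUnit ((proj q).1 * (proj (adjointMap q)).1 * (proj q).1 + 1 - (proj q).1)
  generalize (proj q).1 = p at *
  generalize (proj (adjointMap q)).1 = p' at *
  refine ⟨⟨_, q.1 * star q.1 + 1 - p, ?_, ?_⟩, rfl⟩
  · linear_combination (norm := noncomm_ring) p * p' * h₁ * star q.1 + p * h₄ * star q.1 +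
      p * h₆ + h₅ - h₁ * star q.1 - p * p' * h₉ + h₉
  · linear_combination (norm := noncomm_ring) q.1 * h₈ * p' * p + q.1 * h₇ * p + h₃ * p + h₂ -
      q.1 * h₈ - h₉ * p' * p + h₉

theorem inverseExtension_compactification (q : CotangentGrassmannian H n) :
    inverseExtension (compactification n q).1 = q.1 := by
  have h : gram (compactification n q).1 * q.1 = (proj q).1 * (proj (adjointMap q)).1 := by
    change ((proj q).1 * (proj (adjointMap q)).1 * (proj q).1 + 1 - (proj q).1) * q.1 = _
    linear_combination (norm := noncomm_ring) (proj q).1 * (proj (adjointMap q)).1 *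
      proj_mul_self q + (proj q).1 * proj_adjointMap_mul_self q - proj_mul_self q
  calc inverseExtension (compactification n q).1
      = Ring.inverse (gram (compactification n q).1) * (gram (compactification n q).1 * q.1) := by
        rw [h]; rfl
    _ = q.1 := Ring.inverse_mul_cancel_left _ _ (isUnit_gram_compactification q)

/-- Both the map and its left inverse are restrictions of continuous maps of the ambient spaces. -/
theorem isInducing_compactification :
    Topology.IsInducing (compactification (H := H) n) := by
  rw [Topology.isInducing_iff_nhds]
  intro x
  refine le_antisymm ?_ ?_
  · rw [← Filter.map_le_iff_le_comap]
    have h := isLocalExtension_compactification x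
    refine ((Topology.IsInducing.subtypeVal.tendsto_nhds_iff).2 ?_)
    have := ((h.smooth.continuousOn.continuousAt (h.isOpen.mem_nhds h.mem)).comp
      (f := Subtype.val) continuous_subtype_val.continuousAt).tendsto
    have e : (fun a : H →L[ℂ] H => (projExtension a, projExtension (star a))) ∘ Subtype.val =
        Subtype.val ∘ compactification n := funext fun y =>
      h.agree y (isUnit_add_star_sub_one y)
    rwa [e] at this
  · have hU := isOpen_isUnit_gram.mem_nhds (isUnit_gram_compactification x)
    have := ((contDiffOn_inverseExtension.continuousOn.continuousAt hU).comp
      (f := Subtype.val) continuous_subtype_val.continuousAt).tendsto.comp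
        (Filter.tendsto_comap (f := compactification n))
    have e : (inverseExtension ∘ Subtype.val) ∘ compactification n =
        (Subtype.val : CotangentGrassmannian H n → _) :=
      funext fun y => inverseExtension_compactification y
    rw [e] at this
    refine (Filter.tendsto_iff_comap.1 this).trans_eq ?_
    rw [Function.comp_apply, inverseExtension_compactification, ← nhds_subtype_eq_comap]

theorem compactification_injective : Function.Injective (compactification (H := H) n) := by
  intro x y h
  apply Subtype.ext
  rw [← inverseExtension_compactification x, h, inverseExtension_compactification]

/-! ### The differential of the compactification map -/

/-- The derivative of `π` in the direction `v` at an idempotent whose image has orthogonal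
projection `p`: the block of `v` from the image of `p` to its complement, plus its adjoint. -/
noncomputable def projDeriv (p v : H →L[ℂ] H) : H →L[ℂ] H :=
  (1 - p) * v * p + star ((1 - p) * v * p)

/-- The equations obtained by differentiating `π(q) q = q`, `π(q)² = π(q)` and `π(q)* = π(q)`
determine the derivative `w` of `π`. -/
theorem eq_projDeriv (hp : star p = p) (hqp : q * p = p)
    (h : w * q + p * v = v) (hw : w * p + p * w = w) (hs : star w = w) :
    w = projDeriv p v := by
  have h₁ : (1 - p) * v * p = w * p := by
    linear_combination (norm := noncomm_ring) -h * p + w * hqp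
  rw [projDeriv, h₁, star_mul, hs, hp, hw]

theorem IsLocalExtension.eventually_mem {E F : Type*} [NormedAddCommGroup E] [NormedSpace ℝ E]
    [NormedAddCommGroup F] [NormedSpace ℝ F] {S : Set E} {S' : Set F} {f : S → S'} {x : S}
    {U : Set E} {G : E → F} (h : IsLocalExtension f x U G) {γ : ℝ → E} (hγ : ContinuousAt γ 0)
    (h0 : γ 0 = x) : ∀ᶠ t in 𝓝 (0 : ℝ), γ t ∈ U :=
  hγ (h.isOpen.mem_nhds (h0 ▸ h.mem))

/-- Any local extension of the compactification map has the same derivative on tangent vectors,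
since this derivative only depends on the values of the map along curves of idempotents. -/
theorem differential_compactification {x : CotangentGrassmannian H n}
    {L : (H →L[ℂ] H) →L[ℝ] (H →L[ℂ] H) × (H →L[ℂ] H)}
    (hL : IsDifferentialAt (compactification n) x L)
    (hv : v ∈ TangentVectors (CotangentGrassmannian H n) x) :
    L v = (projDeriv (proj x).1 v, projDeriv (proj (adjointMap x)).1 (star v)) := by
  obtain ⟨U, G, h, rfl⟩ := hL
  obtain ⟨γ, -, hγ, h0, hd⟩ := hv
  have hG : HasFDerivAt G (fderiv ℝ G x) (γ 0) := by
    rw [h0]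
    exact ((h.smooth.contDiffAt (h.isOpen.mem_nhds h.mem)).differentiableAt
      (by simp)).hasFDerivAt
  have hd' := hG.comp_hasDerivAt (0 : ℝ) hd
  have hd₁ : HasDerivAt (fun t => (G (γ t)).1) (fderiv ℝ G x v).1 0 :=
    (ContinuousLinearMap.fst ℝ (H →L[ℂ] H) (H →L[ℂ] H)).hasFDerivAt.comp_hasDerivAt (0 : ℝ) hd'
  have hd₂ : HasDerivAt (fun t => (G (γ t)).2) (fderiv ℝ G x v).2 0 :=
    (ContinuousLinearMap.snd ℝ (H →L[ℂ] H) (H →L[ℂ] H)).hasFDerivAt.comp_hasDerivAt (0 : ℝ) hd'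
  have hev : ∀ᶠ t in 𝓝 (0 : ℝ), ∃ y : CotangentGrassmannian H n,
      y.1 = γ t ∧ G (γ t) = (compactification n y).1 := by
    filter_upwards [hγ, h.eventually_mem hd.continuousAt h0] with t ht ht'
    exact ⟨⟨γ t, ht⟩, rfl, h.agree ⟨γ t, ht⟩ ht'⟩
  have hG0 : G (γ 0) = (compactification n x).1 := by rw [h0]; exact h.agree x h.mem
  refine Prod.ext ?_ ?_
  · refine eq_projDeriv (star_proj x) (self_mul_proj x) ?_ ?_ ?_
    · have := deriv_mul_eq hd₁ hd hd (hev.mono fun t ⟨y, hy, e⟩ => by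
        rw [e, ← hy]; exact proj_mul_self y)
      rwa [h0, ← h0, hG0, h0] at this
    · have := deriv_mul_eq hd₁ hd₁ hd₁ (hev.mono fun t ⟨y, hy, e⟩ => by
        rw [e]; exact (proj y).2.1)
      rwa [hG0] at this
    · exact (hasDerivAt_star hd₁).unique (hd₁.congr_of_eventuallyEq
        (hev.mono fun t ⟨y, hy, e⟩ => by
        change star (G (γ t)).1 = (G (γ t)).1; rw [e]; exact star_proj y))
  · refine eq_projDeriv (star_proj (adjointMap x)) (self_mul_proj (adjointMap x))
      ?_ ?_ ?_
    · have := deriv_mul_eq hd₂ (hasDerivAt_star hd) (hasDerivAt_star hd)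
        (hev.mono fun t ⟨y, hy, e⟩ => by
          rw [e, ← hy]; exact proj_mul_self (adjointMap y))
      rw [hG0, h0] at this
      exact this
    · have := deriv_mul_eq hd₂ hd₂ hd₂ (hev.mono fun t ⟨y, hy, e⟩ => by
        rw [e]; exact (proj (adjointMap y)).2.1)
      rwa [hG0] at this
    · exact (hasDerivAt_star hd₂).unique (hd₂.congr_of_eventuallyEq
        (hev.mono fun t ⟨y, hy, e⟩ => by
        change star (G (γ t)).2 = (G (γ t)).2; rw [e]; exact star_proj (adjointMap y)))

/-! ### Holomorphy -/

theorem structureJ_projDeriv (hp : star p = p) (hpp : p * p = p) :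
    structureJ p (projDeriv p v) = projDeriv p (Complex.I • v) := by
  have h : projDeriv p v * p - p * projDeriv p v =
      (1 - p) * v * p - star ((1 - p) * v * p) := by
    simp only [projDeriv, star_mul, star_sub, star_one, hp]
    linear_combination (norm := noncomm_ring) v * hpp - p * v * hpp + hpp * v * p
      - hpp * star v + hpp * star v * p - p * star v * hpp
  rw [structureJ_apply, h, projDeriv, mul_smul_comm, smul_mul_assoc, star_smul,
    RCLike.star_def, Complex.conj_I, neg_smul, smul_sub, sub_eq_add_neg]

/-- Since `q v p` has its image in that of `p`, the operators `i [v, q]` and `i v` have the same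
block from the image of `p` to its complement. -/
theorem projDeriv_structureJ (hqp : q * p = p) (hpq : p * q = q) :
    projDeriv p (structureJ q v) = projDeriv p (Complex.I • v) := by
  have h : (1 - p) * (v * q - q * v) * p = (1 - p) * v * p := by
    linear_combination (norm := noncomm_ring) (1 - p) * v * hqp + hpq * v * p
  rw [projDeriv, structureJ_apply, mul_smul_comm, smul_mul_assoc, h, projDeriv, mul_smul_comm,
    smul_mul_assoc]

theorem projDeriv_neg : projDeriv p (-v) = -projDeriv p v := by
  rw [projDeriv, projDeriv, mul_neg, neg_mul, star_neg, neg_add]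

theorem isHolomorphicMap_compactification_structureJ :
    IsHolomorphicMap structureJ structureJJ (compactification (H := H) n) where
  source := isAlmostComplexOn_structureJ
  target := isAlmostComplexOn_structureJJ
  smooth := isSmoothMap_compactification
  comm x L hL v hv := by
    rw [differential_compactification hL hv,
      differential_compactification hL (isAlmostComplexOn_structureJ.1 _ x.2 v hv),
      star_structureJ]
    refine Prod.ext ?_ ?_
    · exact (projDeriv_structureJ (self_mul_proj x) (proj_mul_self x)).trans
        (structureJ_projDeriv (star_proj x) (proj x).2.1).symm
    · exact (projDeriv_structureJ (self_mul_proj (adjointMap x))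
        (proj_mul_self (adjointMap x))).trans
        (structureJ_projDeriv (star_proj (adjointMap x)) (proj (adjointMap x)).2.1).symm

theorem isHolomorphicMap_compactification_structureI :
    IsHolomorphicMap structureI structureJnegJ (compactification (H := H) n) where
  source := isAlmostComplexOn_structureI
  target := isAlmostComplexOn_structureJnegJ
  smooth := isSmoothMap_compactification
  comm x L hL v hv := by
    rw [differential_compactification hL hv,
      differential_compactification hL (isAlmostComplexOn_structureI.1 _ x.2 v hv),
      structureI_apply, star_smul, RCLike.star_def, Complex.conj_I, neg_smul, projDeriv_neg,
      ← structureJ_projDeriv (star_proj x) (proj x).2.1,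
      ← structureJ_projDeriv (star_proj (adjointMap x)) (proj (adjointMap x)).2.1]
    rfl

/-! ### The image of the compactification map -/

omit [CompleteSpace H] in
theorem mem_range_iff_of_mul_self (hp : p * p = p) {x : H} : x ∈ p.range ↔ p x = x := by
  refine ⟨?_, fun h => ⟨x, h⟩⟩
  rintro ⟨y, rfl⟩
  exact congrArg (fun f : H →L[ℂ] H => f y) hp

theorem mem_orthogonal_range_iff (hp : star p = p) {x : H} : x ∈ p.rangeᗮ ↔ p x = 0 := by
  rw [ContinuousLinearMap.orthogonal_range, ← ContinuousLinearMap.star_eq_adjoint, hp]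
  rfl

/-- For Hermitian projections `p`, `p'` of the same finite rank, `H` is the direct sum of the
image of `p` and the kernel of `p'` as soon as the two intersect trivially. -/
theorem isCompl_range_orthogonal_range_iff (hp : p ∈ Grassmannian H n)
    (hp' : p' ∈ Grassmannian H n) :
    IsCompl p.range p'.rangeᗮ ↔ ∀ x, p x = x → p' x = 0 → x = 0 := by
  have : FiniteDimensional ℂ p.range := finiteDimensional_range hp.2.1
  have : FiniteDimensional ℂ p'.range := finiteDimensional_range hp'.2.1
  constructor
  · intro h x hx hx'
    exact Submodule.disjoint_def.1 h.disjoint x ((mem_range_iff_of_mul_self hp.1).2 hx)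
      ((mem_orthogonal_range_iff hp'.2.2).2 hx')
  · intro h
    refine ⟨Submodule.disjoint_def.2 fun x hx hx' =>
      h x ((mem_range_iff_of_mul_self hp.1).1 hx) ((mem_orthogonal_range_iff hp'.2.2).1 hx'), ?_⟩
    -- `p'` maps the image of `p` injectively, hence surjectively, to the image of `p'`
    let T : p.range →ₗ[ℂ] p'.range :=
      ((p' : H →ₗ[ℂ] H).comp p.range.subtype).codRestrict p'.range fun x => ⟨x, rfl⟩
    have hT : Function.Injective T := by
      rw [injective_iff_map_eq_zero]
      rintro ⟨x, hx⟩ hTx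
      exact Subtype.ext (h x ((mem_range_iff_of_mul_self hp.1).1 hx) (congrArg Subtype.val hTx))
    have hd : Module.finrank ℂ p.range = Module.finrank ℂ p'.range := by
      rw [Module.finrank_eq_of_rank_eq hp.2.1, Module.finrank_eq_of_rank_eq hp'.2.1]
    rw [LinearMap.injective_iff_surjective_of_finrank_eq_finrank hd] at hT
    rw [Submodule.codisjoint_iff_exists_add_eq]
    intro z
    obtain ⟨⟨y, hy⟩, hyz⟩ := hT ⟨p' z, z, rfl⟩
    refine ⟨y, z - y, hy, (mem_orthogonal_range_iff hp'.2.2).2 ?_, by abel⟩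
    rw [map_sub, sub_eq_zero]
    exact (congrArg Subtype.val hyz).symm

theorem range_compactification :
    Set.range (compactification (H := H) n) =
      {x : ↥(Grassmannian H n ×ˢ Grassmannian H n) |
        IsCompl x.val.1.range x.val.2.rangeᗮ} := by
  ext ⟨⟨p, p'⟩, hp, hp'⟩
  change p ∈ Grassmannian H n at hp
  change p' ∈ Grassmannian H n at hp'
  constructor
  · rintro ⟨q, hq⟩
    obtain ⟨h₁, h₂⟩ : (proj q).1 = p ∧ (proj (adjointMap q)).1 = p' :=
      Prod.mk.inj (congrArg Subtype.val hq)
    subst h₁ h₂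
    refine (isCompl_range_orthogonal_range_iff hp hp').2 fun x hx hx' => ?_
    have h₁ : q.1 ((proj q).1 x) = (proj q).1 x :=
      congrArg (fun f : H →L[ℂ] H => f x) (self_mul_proj q)
    have h₂ : q.1 ((proj (adjointMap q)).1 x) = q.1 x :=
      congrArg (fun f : H →L[ℂ] H => f x) (self_mul_proj_adjointMap q)
    rw [hx] at h₁
    rw [hx', map_zero, h₁] at h₂
    exact h₂.symm
  · intro (h : IsCompl p.range p'.rangeᗮ)
    have : FiniteDimensional ℂ p.range := finiteDimensional_range hp.2.1
    have hc : Submodule.IsTopCompl p.range p'.rangeᗮ :=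
      Submodule.IsCompl.isTopCompl_of_isClosed h (Submodule.closed_of_finiteDimensional _)
        (Submodule.isClosed_orthogonal _)
    set q : H →L[ℂ] H := p.range.projectionL p'.rangeᗮ hc with hqdef
    have hqq : q * q = q := Submodule.isIdempotentElem_projectionL hc
    have hqr : q.range = p.range := Submodule.range_projectionL hc
    have hpq : p * q = q := by
      ext x
      exact (mem_range_iff_of_mul_self hp.1).1 (Submodule.projectionL_apply_mem hc x)
    have hqp : q * p = p := by
      ext x
      exact (Submodule.projectionL_eq_self_iff hc (p x)).2 ⟨x, rfl⟩
    have hp'q : p' * q = p' := by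
      ext x
      have : q (x - q x) = 0 := by
        rw [map_sub, sub_eq_zero]
        exact (congrArg (fun f : H →L[ℂ] H => f x) hqq).symm
      rw [hqdef, Submodule.projectionL_apply_eq_zero_iff, mem_orthogonal_range_iff hp'.2.2,
        map_sub, sub_eq_zero] at this
      exact this.symm
    have hqp' : q * p' = q := by
      ext x
      have : p' (x - p' x) = 0 := by
        rw [map_sub, sub_eq_zero]
        exact (congrArg (fun f : H →L[ℂ] H => f x) hp'.1).symm
      rw [← mem_orthogonal_range_iff hp'.2.2, ← Submodule.projectionL_apply_eq_zero_iff hc,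
        map_sub, sub_eq_zero] at this
      exact this.symm
    have hq : q ∈ CotangentGrassmannian H n := ⟨hqq, by rw [hqr]; exact hp.2.1⟩
    refine ⟨⟨q, hq⟩, Subtype.ext (Prod.ext ?_ ?_)⟩
    · exact proj_eq_of_mul_eq ⟨q, hq⟩ hp.2.2 hpq hqp
    · refine proj_eq_of_mul_eq (adjointMap ⟨q, hq⟩) hp'.2.2 ?_ ?_
      · have := congrArg star hqp'
        rwa [star_mul, show star p' = p' from hp'.2.2] at this
      · have := congrArg star hp'q
        rwa [star_mul, show star p' = p' from hp'.2.2] at this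

theorem mem_range_compactification_iff {x : ↥(Grassmannian H n ×ˢ Grassmannian H n)} :
    x ∈ Set.range (compactification (H := H) n) ↔
      ∀ y, x.1.1 y = y → x.1.2 y = 0 → y = 0 := by
  rw [range_compactification]
  exact isCompl_range_orthogonal_range_iff x.2.1 x.2.2

/-- The image is the set of pairs where `gram` is invertible; in particular it is open. -/
theorem range_compactification_eq_preimage :
    Set.range (compactification (H := H) n) = Subtype.val ⁻¹' {x | IsUnit (gram x)} := by
  ext x
  constructor
  · rintro ⟨q, rfl⟩
    exact isUnit_gram_compactification q
  · rintro ⟨u, hu⟩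
    rw [mem_range_compactification_iff]
    intro y hy hy'
    have h : gram x.1 y = 0 := by
      change x.1.1 (x.1.2 (x.1.1 y)) + y - x.1.1 y = 0
      rw [hy, hy', map_zero, zero_add, sub_self]
    have h₁ : (u⁻¹).1 (u.1 y) = y := congrArg (fun f : H →L[ℂ] H => f y) u.inv_mul
    rw [← h₁, hu, h, map_zero]

theorem isSmoothOpenEmbedding_compactification :
    IsSmoothOpenEmbedding (compactification (H := H) n) where
  smooth := isSmoothMap_compactification
  isOpenEmbedding :=
    { toIsInducing := isInducing_compactification
      injective := compactification_injective
      isOpen_range := by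
        rw [range_compactification_eq_preimage]
        exact isOpen_isUnit_gram.preimage continuous_subtype_val }
  smooth_inverse x := ⟨_, inverseExtension, isOpen_isUnit_gram, isUnit_gram_compactification x,
    contDiffOn_inverseExtension, fun y _ => inverseExtension_compactification y⟩

/-! ### Density of the image -/

theorem projExtension_of_mem_grassmannian (hp : p ∈ Grassmannian H n) : projExtension p = p := by
  have hp' := (mem_grassmannian_iff.1 hp).1
  rw [projExtension_eq ⟨p, hp'⟩]
  exact proj_eq_of_mul_eq ⟨p, hp'⟩ hp.2.2 hp.1 hp.1

theorem denseRange_compactification : DenseRange (compactification (H := H) n) := by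
  rintro ⟨⟨p, p'⟩, hp, hp'⟩
  change p ∈ Grassmannian H n at hp
  change p' ∈ Grassmannian H n at hp'
  have : FiniteDimensional ℂ p.range := finiteDimensional_range hp.2.1
  have : FiniteDimensional ℂ p'.range := finiteDimensional_range hp'.2.1
  have hd : Module.finrank ℂ p.range = Module.finrank ℂ p'.range := by
    rw [Module.finrank_eq_of_rank_eq hp.2.1, Module.finrank_eq_of_rank_eq hp'.2.1]
  -- `K` extends an isomorphism `e` between the images of `p` and `p'` by zero, and `N` is the
  -- inverse of `e` applied after `p'`
  let e : p.range ≃ₗ[ℂ] p'.range := LinearEquiv.ofFinrankEq _ _ hd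
  let P : H →L[ℂ] p.range := p.codRestrict p.range fun x => ⟨x, rfl⟩
  let P' : H →L[ℂ] p'.range := p'.codRestrict p'.range fun x => ⟨x, rfl⟩
  let K : H →L[ℂ] H := p'.range.subtypeL ∘L (LinearMap.toContinuousLinearMap e.toLinearMap) ∘L P
  let N : Module.End ℂ p.range := e.symm.toLinearMap ∘ₗ P'.toLinearMap ∘ₗ p.range.subtype
  let g : ℝ → H →L[ℂ] H := fun t => 1 + t • star K
  have hg : Continuous g := continuous_const.add (continuous_id.smul continuous_const)
  have hg0 : g 0 = 1 := by simp [g]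
  -- `q t` is an idempotent with image `g t (p' H)`, tending to `p'` as `t → 0`
  let q : ℝ → H →L[ℂ] H := fun t => g t * p' * Ring.inverse (g t)
  have hq0 : q 0 = p' := by simp [q, hg0]
  have hp'c := (mem_grassmannian_iff.1 hp').1
  have hqc : ContinuousAt q 0 := by
    have h1 : ContinuousAt Ring.inverse (g 0) := by
      rw [hg0]; exact NormedRing.inverse_continuousAt 1
    exact (hg.continuousAt.mul continuousAt_const).mul (h1.comp hg.continuousAt)
  have hlim : Filter.Tendsto (fun t => (p, projExtension (q t))) (𝓝[≠] (0 : ℝ)) (𝓝 (p, p')) := by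
    have h1 : ContinuousAt (projExtension : (H →L[ℂ] H) → _) (q 0) :=
      contDiffOn_projExtension.continuousOn.continuousAt (isOpen_isUnit_add_star_sub_one.mem_nhds
        (by rw [hq0]; exact isUnit_add_star_sub_one ⟨p', hp'c⟩))
    have h2 := (h1.comp hqc).tendsto
    rw [Function.comp_apply, hq0, projExtension_of_mem_grassmannian hp'] at h2
    exact (tendsto_const_nhds.prodMk_nhds h2).mono_left nhdsWithin_le_nhds
  rw [closure_subtype]
  refine mem_closure_of_tendsto hlim ?_
  have hunit : ∀ᶠ t in 𝓝[≠] (0 : ℝ), IsUnit (g t) :=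
    (hg.continuousAt.eventually (Units.isOpen.mem_nhds (by rw [hg0]; exact isUnit_one))).filter_mono
      nhdsWithin_le_nhds
  have hev : ∀ᶠ t : ℝ in 𝓝[≠] 0, ¬ N.HasEigenvalue (-(t : ℂ)) := by
    have hfin : {t : ℝ | N.HasEigenvalue (-(t : ℂ))}.Finite :=
      (Module.End.finite_hasEigenvalue N).preimage
        ((neg_injective.comp Complex.ofReal_injective).injOn)
    exact nhdsNE_le_cofinite 0 hfin.compl_mem_cofinite
  filter_upwards [hunit, hev] with t ht ht'
  have hwg : Ring.inverse (g t) * g t = 1 := Ring.inverse_mul_cancel _ ht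
  have hq : q t ∈ CotangentGrassmannian H n := conj_mem_cotangentGrassmannian hwg hp'c
  have hpt : projExtension (q t) = (proj ⟨q t, hq⟩).1 := projExtension_eq ⟨q t, hq⟩
  have hmem : projExtension (q t) ∈ Grassmannian H n := by
    rw [hpt]; exact (proj ⟨q t, hq⟩).2
  refine ⟨⟨(p, projExtension (q t)), hp, hmem⟩, mem_range_compactification_iff.2 ?_, rfl⟩
  intro x (hx : p x = x) (hx' : projExtension (q t) x = 0)
  -- `x` is orthogonal to the image of `g t * p'`, that is, `p' (star (g t) x) = 0`
  have h₁ : p' (star (g t) x) = 0 := by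
    have hs : star (q t) * projExtension (q t) = star (q t) := by
      have := congrArg star (proj_mul_self ⟨q t, hq⟩)
      rwa [star_mul, star_proj, ← hpt] at this
    have hs' : p' * star (g t) = star (g t) * star (q t) := by
      have hsp : star p' = p' := hp'.2.2
      have h₀ : q t * g t = g t * p' := by
        simp only [q]
        rw [mul_assoc, hwg, mul_one]
      have := congrArg star h₀
      rw [star_mul (q t), star_mul (g t), hsp] at this
      exact this.symm
    have h₂ : p' (star (g t) x) = star (g t) (star (q t) x) :=
      congrArg (fun f : H →L[ℂ] H => f x) hs'
    have h₃ : star (q t) (projExtension (q t) x) = star (q t) x :=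
      congrArg (fun f : H →L[ℂ] H => f x) hs
    rw [h₂, ← h₃, hx', map_zero, map_zero]
  have hsg : star (g t) x = x + (t : ℂ) • K x := by
    have : star (g t) = 1 + t • K := by
      simp only [g, star_add, star_one, star_smul, star_star, star_trivial]
    rw [this]
    rfl
  let y : p.range := ⟨x, x, hx⟩
  have hPx : P x = y := Subtype.ext hx
  have hKx : K x = e y := by
    change ((e (P x) : p'.range) : H) = _
    rw [hPx]
  have h₂ : P' x = -((t : ℂ) • e y) := by
    apply Subtype.ext
    change p' x = -((t : ℂ) • (e y : H))
    rw [hsg, map_add, map_smul, hKx, (mem_range_iff_of_mul_self hp'.1).1 (e y).2] at h₁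
    exact eq_neg_of_add_eq_zero_left h₁
  -- hence `x` is an eigenvector of `N` unless it vanishes
  have h₃ : N y = (-(t : ℂ)) • y := by
    change e.symm (P' x) = _
    rw [h₂, map_neg, map_smul, LinearEquiv.symm_apply_apply, neg_smul]
  by_contra hx0
  exact ht' (Module.End.hasEigenvalue_of_hasEigenvector
    ⟨Module.End.mem_eigenspace_iff.2 h₃, fun h => hx0 (congrArg Subtype.val h)⟩)

/-! ### Pairs of orthogonal projections -/

theorem range_compactification_one :
    Set.range (compactification (H := H) 1) =
      {x : ↥(Grassmannian H 1 ×ˢ Grassmannian H 1) | x.val.1 * x.val.2 ≠ 0} := by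
  ext ⟨⟨p, p'⟩, hp, hp'⟩
  change p ∈ Grassmannian H 1 at hp
  change p' ∈ Grassmannian H 1 at hp'
  have hsp : star p = p := hp.2.2
  have hsp' : star p' = p' := hp'.2.2
  have hr : Module.finrank ℂ p.range = 1 := Module.finrank_eq_of_rank_eq (by simpa using hp.2.1)
  rw [mem_range_compactification_iff]
  change (∀ y, p y = y → p' y = 0 → y = 0) ↔ p * p' ≠ 0
  constructor
  · intro h h0
    have h0' : p' * p = 0 := by
      have := congrArg star h0
      rwa [star_mul, hsp, hsp', star_zero] at this
    have hbot : ∀ y : p.range, y = 0 := fun ⟨y, hy⟩ => by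
      have hy' := (mem_range_iff_of_mul_self hp.1).1 hy
      refine Subtype.ext (h y hy' ?_)
      rw [← hy']
      exact congrArg (fun f : H →L[ℂ] H => f y) h0'
    have : Subsingleton p.range := ⟨fun a b => (hbot a).trans (hbot b).symm⟩
    rw [Module.finrank_zero_of_subsingleton] at hr
    exact zero_ne_one hr
  · intro h y hy hy'
    by_contra hy0
    refine h ?_
    have h0' : p' * p = 0 := by
      ext z
      have hv : (⟨y, y, hy⟩ : p.range) ≠ 0 := fun h => hy0 (congrArg Subtype.val h)
      obtain ⟨c, hc⟩ := (finrank_eq_one_iff_of_nonzero' _ hv).1 hr ⟨p z, z, rfl⟩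
      have hc' : c • y = p z := congrArg Subtype.val hc
      change p' (p z) = 0
      rw [← hc', map_smul, hy', smul_zero]
    have := congrArg star h0'
    rwa [star_mul, hsp, hsp', star_zero] at this

/-- A generator of a unitary one-parameter group moving the pair `(p, q)` of mutually orthogonal
projections with velocity `(A, B)`. -/
noncomputable def pairGenerator (p q A B : H →L[ℂ] H) : H →L[ℂ] H :=
  (A * p - p * A) + ((1 - p - q) * B * q - q * B * (1 - p - q))

/-- The tangent vectors of the set of pairs of mutually orthogonal projections are the solutions
of the linearized equations: such a solution is the velocity of the orbit of the pair under the
unitary one-parameter group with generator `pairGenerator`. -/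
theorem mem_tangentVectors_orthogonal_pairs {x A : (H →L[ℂ] H) × (H →L[ℂ] H)}
    (hx : x ∈ {x ∈ Grassmannian H n ×ˢ Grassmannian H n | x.1 * x.2 = 0}) :
    A ∈ TangentVectors {x ∈ Grassmannian H n ×ˢ Grassmannian H n | x.1 * x.2 = 0} x ↔
      A ∈ TangentVectors (Grassmannian H n ×ˢ Grassmannian H n) x ∧
        A.1 * x.2 + x.1 * A.2 = 0 := by
  obtain ⟨p, q⟩ := x
  obtain ⟨⟨hp, hq⟩, hpq⟩ := hx
  obtain ⟨A, B⟩ := A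
  change p ∈ Grassmannian H n at hp
  change q ∈ Grassmannian H n at hq
  change p * q = 0 at hpq
  have hsp : star p = p := hp.2.2
  have hsq : star q = q := hq.2.2
  constructor
  · rintro ⟨γ, hs, hγ, h0, hd⟩
    refine ⟨⟨γ, hs, hγ.mono fun t ht => ht.1, h0, hd⟩, ?_⟩
    have hd₁ : HasDerivAt (fun t => (γ t).1) A 0 :=
      (ContinuousLinearMap.fst ℝ (H →L[ℂ] H) (H →L[ℂ] H)).hasFDerivAt.comp_hasDerivAt (0 : ℝ) hd
    have hd₂ : HasDerivAt (fun t => (γ t).2) B 0 :=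
      (ContinuousLinearMap.snd ℝ (H →L[ℂ] H) (H →L[ℂ] H)).hasFDerivAt.comp_hasDerivAt (0 : ℝ) hd
    have := deriv_mul_eq hd₁ hd₂ (hasDerivAt_const (0 : ℝ) (0 : H →L[ℂ] H))
      (hγ.mono fun t ht => ht.2)
    rwa [h0] at this
  · rintro ⟨hAB, h⟩
    rw [mem_tangentVectors_prod, mem_tangentVectors_grassmannian hp,
      mem_tangentVectors_grassmannian hq] at hAB
    obtain ⟨⟨hA, hsA⟩, hB, hsB⟩ := hAB
    change A * p + p * A = A at hA
    change B * q + q * B = B at hB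
    change star A = A at hsA
    change star B = B at hsB
    change A * q + p * B = 0 at h
    have hqp : q * p = 0 := by
      have := congrArg star hpq
      rwa [star_mul, hsp, hsq, star_zero] at this
    have h' : q * A + B * p = 0 := by
      have := congrArg star h
      rwa [star_add, star_mul, star_mul, hsp, hsq, hsA, hsB, star_zero] at this
    have hpp : p * p = p := hp.1
    have hqq : q * q = q := hq.1
    set X := pairGenerator p q A B with hX
    have hsX : star X = -X := by
      simp only [hX, pairGenerator, star_add, star_sub, star_mul, star_one, hsp, hsq, hsA, hsB]
      noncomm_ring
    have hXp : X * p - p * X = A := by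
      have h₁ : ((1 - p - q) * B * q - q * B * (1 - p - q)) * p = 0 := by
        linear_combination (norm := noncomm_ring) (1 - p - q) * B * hqp + q * B * hpp
          + q * B * hqp
      have h₂ : p * ((1 - p - q) * B * q - q * B * (1 - p - q)) = 0 := by
        linear_combination (norm := noncomm_ring) -hpp * B * q - hpq * B * q
          - hpq * B * (1 - p - q)
      rw [hX, pairGenerator]
      linear_combination (norm := noncomm_ring) h₁ - h₂ + commutator_commutator hpp hA
    have hXq : X * q - q * X = B := by
      have h₁ : (A * p - p * A) * q - q * (A * p - p * A) = p * B * q + q * B * p := by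
        linear_combination (norm := noncomm_ring) A * hpq + hqp * A - p * h * q - q * h' * p
          + p * A * hqq + hqq * A * p + hpp * B * q + q * B * hpp
      have h₂ : ((1 - p - q) * B * q - q * B * (1 - p - q)) * q
          - q * ((1 - p - q) * B * q - q * B * (1 - p - q)) =
          (1 - p - q) * B * q + q * B * (1 - p - q) := by
        linear_combination (norm := noncomm_ring) (1 - p - q) * B * hqq + q * B * hpq
          + q * B * hqq + hqp * B * q + hqq * B * q + hqq * B * (1 - p - q)
      rw [hX, pairGenerator]
      linear_combination (norm := noncomm_ring) h₁ + h₂ + hB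
        - (2 : H →L[ℂ] H) * mul_mul_eq_zero_of_tangent hqq hB
    refine ⟨fun t => (conjCurve X p t, conjCurve X q t),
      contDiff_conjCurve.prodMk contDiff_conjCurve, .of_forall fun t =>
        ⟨⟨conjCurve_mem_grassmannian hsX hp t, conjCurve_mem_grassmannian hsX hq t⟩, ?_⟩,
      Prod.ext conjCurve_zero conjCurve_zero, ?_⟩
    · change conjCurve X p t * conjCurve X q t = 0
      rw [conjCurve_mul_conjCurve, hpq, conjCurve, mul_zero, zero_mul]
    · have h₁ := hasDerivAt_conjCurve (X := X) (q := p)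
      have h₂ := hasDerivAt_conjCurve (X := X) (q := q)
      rw [hXp] at h₁
      rw [hXq] at h₂
      exact h₁.prodMk h₂

theorem isPreservedBy_orthogonal_pairs :
    IsPreservedBy {x ∈ Grassmannian H n ×ˢ Grassmannian H n | x.1 * x.2 = 0}
      (structureJnegJ (H := H)) := by
  intro x hx A hA
  rw [mem_tangentVectors_orthogonal_pairs hx] at hA ⊢
  refine ⟨isAlmostComplexOn_structureJnegJ.1 x hx.1 A hA.1, ?_⟩
  obtain ⟨p, q⟩ := x
  obtain ⟨⟨hp, hq⟩, hpq⟩ := hx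
  obtain ⟨A, B⟩ := A
  change p * q = 0 at hpq
  have h : A * q + p * B = 0 := hA.2
  change structureJ p A * q + p * (-structureJ q B) = 0
  have h₁ : (A * p - p * A) * q - p * (B * q - q * B) = 0 := by
    linear_combination (norm := noncomm_ring) A * hpq + hpq * B - p * h * q
      + p * A * hq.1 + hp.1 * B * q
  rw [structureJ_apply, structureJ_apply, mul_neg, smul_mul_assoc, mul_smul_comm,
    ← sub_eq_add_neg, ← smul_sub, h₁, smul_zero]

theorem diff_range_compactification_one :
    (Grassmannian H 1 ×ˢ Grassmannian H 1) \
        (Subtype.val '' Set.range (compactification (H := H) 1)) =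
      {x ∈ Grassmannian H 1 ×ˢ Grassmannian H 1 | x.1 * x.2 = 0} := by
  rw [range_compactification_one]
  ext x
  constructor
  · rintro ⟨hx, hx'⟩
    refine ⟨hx, ?_⟩
    by_contra h
    exact hx' ⟨⟨x, hx⟩, h, rfl⟩
  · rintro ⟨hx, hx'⟩
    refine ⟨hx, ?_⟩
    rintro ⟨y, hy, rfl⟩
    exact hy hx'

end Operators

end ProjGeom

theorem mainTheorem4 {H : Type*} [NormedAddCommGroup H] [InnerProductSpace ℂ H]
    [CompleteSpace H] :
    (∀ n : ℕ,
      IsHolomorphicMap structureJ structureJJ (compactification (H := H) n) ∧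
      IsSmoothOpenEmbedding (compactification (H := H) n) ∧
      DenseRange (compactification (H := H) n) ∧
      Set.range (compactification (H := H) n) =
        {x : ↥(Grassmannian H n ×ˢ Grassmannian H n) | IsCompl x.val.1.range x.val.2.rangeᗮ} ∧
      IsHolomorphicMap structureI structureJnegJ (compactification (H := H) n)) ∧
    Set.range (compactification (H := H) 1) =
      {x : ↥(Grassmannian H 1 ×ˢ Grassmannian H 1) | x.val.1 * x.val.2 ≠ 0} ∧
    IsPreservedBy
      ((Grassmannian H 1 ×ˢ Grassmannian H 1) \
        (Subtype.val '' Set.range (compactification (H := H) 1)))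
      structureJnegJ := by
  refine ⟨fun n => ⟨isHolomorphicMap_compactification_structureJ,
    isSmoothOpenEmbedding_compactification, denseRange_compactification, range_compactification,
    isHolomorphicMap_compactification_structureI⟩, range_compactification_one, ?_⟩
  rw [diff_range_compactification_one]
  exact isPreservedBy_orthogonal_pairs
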